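/- A tournament $T=(V,E)$ is a set $V$ (finite or infinite) together with an irreflexive, antisymmetric and complete binary relation $E$ on $V$ (complete: $(x,y)\in E$ or $(y,x)\in E$ whenever $x\neq y$); it is acyclic if it contains no $3$-cycle. The lexicographical sum of a family $(T_i)_{i\in V(D)}$ of tournaments indexed by a tournament $D$ is the tournament on the disjoint union of the sets $V(T_i)$ in which, for $x\in V(T_i)$ and $y\in V(T_j)$, the pair $(x,y)$ is an edge if and only if either $i=j$ and $(x,y)\in E(T_i)$, or $(i,j)\in E(D)$. The profile of $T$ is the function $\varphi_T:\mathbb N\to\mathbb N$ for which $\varphi_T(n)$ is the number of subtournaments induced by $T$ on the $n$-element subsets of $V$, isomorphic tournaments being identified. Theorem. Let $T$ be a tournament. Then exactly one of the following holds: (1) $\varphi_T$ is bounded from above by a polynomial, that is, there is a real polynomial $p$ with $\varphi_T(n)\le p(n)$ for all $n\in\mathbb N$; (2) the growth of $\varphi_T$ is at least exponential, that is, there are real numbers $a>0$ and $c>1$ with $\varphi_T(n)\ge a c^n$ for all $n\in\mathbb N$. Moreover, in case (1), $T$ is (isomorphic to) a lexicographical sum of acyclic tournaments indexed by a finite tournament.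 -/

import Mathlib

universe u v w

/-- A tournament on the vertex set `V`: an irreflexive, antisymmetric and complete binary relation.
`T.Adj x y` says that `(x, y)` is an edge. Finite and infinite vertex sets are allowed. -/
structure Tournament (V : Type u) extends Digraph V where
  irrefl : ∀ x, ¬ Adj x x
  antisymm : ∀ x y, Adj x y → Adj y x → x = y
  complete : ∀ x y, x ≠ y → Adj x y ∨ Adj y x

namespace Tournament

/-- The subtournament induced on a set `A` of vertices. -/
def restrict {V : Type u} (T : Tournament V) (A : Set V) : Tournament A where
  Adj x y := T.Adj x y
  irrefl x := T.irrefl x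
  antisymm x y h h' := Subtype.ext (T.antisymm x y h h')
  complete x y h := T.complete x y (fun e => h (Subtype.ext e))

/-- Two tournaments are isomorphic if some bijection between their vertex sets preserves and
reflects edges. -/
def Isomorphic {V : Type u} {W : Type v} (T : Tournament V) (S : Tournament W) : Prop :=
  Nonempty (T.Adj ≃r S.Adj)

/-- A tournament is acyclic if it has no 3-cycle. (The three vertices of a 3-cycle are automatically
distinct, since edges are irreflexive and antisymmetric.) -/
def IsAcyclic {V : Type u} (T : Tournament V) : Prop :=
  ¬ ∃ a b c : V, T.Adj a b ∧ T.Adj b c ∧ T.Adj c a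

/-- The lexicographical sum of the tournaments `S i` indexed by the tournament `D`. Its vertex set
is the disjoint union of the vertex sets; `(⟨i, x⟩, ⟨j, y⟩)` is an edge if and only if `(i, j)` is an
edge of `D`, or `i = j` and `(x, y)` is an edge of `S i`. -/
def lexSum {ι : Type v} {W : ι → Type w} (D : Tournament ι) (S : ∀ i, Tournament (W i)) :
    Tournament (Σ i, W i) where
  Adj := Sigma.Lex D.Adj (fun i => (S i).Adj)
  irrefl := by
    rintro ⟨i, x⟩ h
    rcases Sigma.lex_iff.1 h with h | ⟨_, h⟩
    · exact D.irrefl i h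
    · exact (S i).irrefl x h
  antisymm := by
    rintro ⟨i, x⟩ ⟨j, y⟩ h h'
    rcases h with ⟨_, _, h⟩ | ⟨_, _, h⟩
    · rcases h' with ⟨_, _, h'⟩ | ⟨_, _, h'⟩
      · obtain rfl := D.antisymm _ _ h h'
        exact (D.irrefl _ h).elim
      · exact (D.irrefl _ h).elim
    · rcases h' with ⟨_, _, h'⟩ | ⟨_, _, h'⟩
      · exact (D.irrefl _ h').elim
      · rw [(S i).antisymm _ _ h h']
  complete := by
    rintro ⟨i, x⟩ ⟨j, y⟩ hne
    by_cases hij : i = j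
    · subst hij
      rcases (S i).complete x y (fun e => hne (by rw [e])) with h | h
      · exact Or.inl (Sigma.Lex.right _ _ h)
      · exact Or.inr (Sigma.Lex.right _ _ h)
    · rcases D.complete i j hij with h | h
      · exact Or.inl (Sigma.Lex.left _ _ h)
      · exact Or.inr (Sigma.Lex.left _ _ h)

/-- `T` is (isomorphic to) a lexicographical sum of acyclic tournaments indexed by a finite
tournament. -/
def IsFiniteLexSumOfAcyclic {V : Type u} (T : Tournament V) : Prop :=
  ∃ (ι : Type) (_ : Finite ι) (D : Tournament ι) (W : ι → Type u) (S : ∀ i, Tournament (W i)),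
    (∀ i, (S i).IsAcyclic) ∧ T.Isomorphic (D.lexSum S)

/-- Isomorphism of the subtournaments induced on the `n`-element sets of vertices. -/
def inducedSetoid {V : Type u} (T : Tournament V) (n : ℕ) :
    Setoid {s : Finset V // s.card = n} where
  r s t := (T.restrict (s.1 : Set V)).Isomorphic (T.restrict (t.1 : Set V))
  iseqv :=
    ⟨fun _ => ⟨RelIso.refl _⟩, fun ⟨e⟩ => ⟨e.symm⟩, fun ⟨e⟩ ⟨f⟩ => ⟨e.trans f⟩⟩

/-- For each `n` there are only finitely many isomorphism types of `n`-element subtournaments, so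
that the cardinality `profile` below is a genuine one. -/
theorem finite_quotient_inducedSetoid {V : Type u} (T : Tournament V) (n : ℕ) :
    Finite (Quotient (T.inducedSetoid n)) := by
  classical
  have e : ∀ s : {s : Finset V // s.card = n}, Fin n ≃ (s.1 : Set V) := fun s =>
    (s.1.equivFinOfCardEq s.2).symm
  let g : {s : Finset V // s.card = n} → Fin n → Fin n → Prop :=
    fun s a b => T.Adj (e s a) (e s b)
  refine Finite.of_injective (fun q : Quotient (T.inducedSetoid n) => g q.out) ?_
  intro p q hpq
  rw [← Quotient.out_equiv_out]
  refine ⟨⟨(e p.out).symm.trans (e q.out), ?_⟩⟩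
  intro a b
  have h := congrFun (congrFun hpq ((e p.out).symm a)) ((e p.out).symm b)
  simp only [g, Equiv.apply_symm_apply] at h
  exact (iff_of_eq h).symm

/-- The profile of `T`: the number of `n`-element induced subtournaments, up to isomorphism. -/
noncomputable def profile {V : Type u} (T : Tournament V) (n : ℕ) : ℕ :=
  Nat.card (Quotient (T.inducedSetoid n))

end Tournament

/-- `f` is bounded from above by a polynomial. -/
def IsPolynomiallyBounded (f : ℕ → ℕ) : Prop :=
  ∃ p : Polynomial ℝ, ∀ n : ℕ, (f n : ℝ) ≤ p.eval (n : ℝ)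

/-- The growth of `f` is at least exponential. -/
def GrowsAtLeastExponentially (f : ℕ → ℕ) : Prop :=
  ∃ a c : ℝ, 0 < a ∧ 1 < c ∧ ∀ n : ℕ, a * c ^ n ≤ (f n : ℝ)

/-! Call two vertices equivalent if some module without 3-cycles contains both. The union of two
intersecting acyclic modules is again one, so this is an equivalence relation. If there are finitely
many classes, `T` is the lexicographical sum of its classes, which are acyclic, and a finite
subtournament is determined up to isomorphism by how many vertices it has in each class: the profile
is polynomially bounded.

If there are infinitely many classes, Ramsey's theorem gives, up to reversing all edges, an
increasing sequence of pairwise inequivalent vertices. Each consecutive pair x → y gets at most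
three further vertices that certify its inequivalence (`exists_isCyclicPattern`). A second use of
Ramsey makes these five-vertex blocks uniform: edges depend only on the labels and on the order of
the blocks. The labels of x and y are then merged, that is, each earlier one dominates each later
other one.

Suppose growth is not exponential. Then a label lying between two merged ones inside a block is
merged too (`merged_of_dia`), so the certificate produces a 3-cycle of merged labels, and the blocks
contain an infinite ordered sum of 3-cycles. Such a sum encodes binary words, which forces
exponential growth after all. The failures of `merged_of_dia` are excluded in the same way, by two
other configurations encoding words. -/

/-! ### Growth of sequences and Ramsey's theorem -/

open Filter Asymptotics in
theorem not_isPolynomiallyBounded_and_growsAtLeastExponentially (f : ℕ → ℕ) :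
    ¬ (IsPolynomiallyBounded f ∧ GrowsAtLeastExponentially f) := by
  rintro ⟨⟨p, hp⟩, a, c, ha, hc, hf⟩
  have hlo : ∀ q : Polynomial ℝ,
      (fun n : ℕ => q.eval (n : ℝ)) =o[atTop] fun n : ℕ => c ^ n := by
    intro q
    induction q using Polynomial.induction_on' with
    | add q r hq hr => simpa using hq.add hr
    | monomial k b =>
      simpa using (isLittleO_pow_const_const_pow_of_one_lt (R := ℝ) k hc).const_mul_left b
  have h := (hlo p).def (half_pos ha)
  obtain ⟨n, hn⟩ := h.exists
  have hcn : 0 < c ^ n := by positivity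
  have h1 := (hf n).trans (hp n)
  rw [Real.norm_eq_abs, Real.norm_eq_abs, abs_of_pos hcn] at hn
  nlinarith [le_abs_self (p.eval (n : ℝ))]

/-- Infinite Ramsey theorem for pairs and finitely many colours. -/
theorem exists_strictMono_homogeneous {κ : Type*} [Finite κ] (c : ℕ → ℕ → κ) :
    ∃ g : ℕ → ℕ, StrictMono g ∧ ∃ k, ∀ i j, i < j → c (g i) (g j) = k := by
  classical
  -- For a nonprincipal ultrafilter, `k i` is the colour of (i, j) for almost all j, and `k₀` is the
  -- value of `k i` for almost all i. A sequence in `{i | k i = k₀}` can then be extended greedily.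
  let U : Ultrafilter ℕ := Filter.hyperfilter ℕ
  have pigeon : ∀ f : ℕ → κ, ∃ k, ∀ᶠ i in (U : Filter ℕ), f i = k := by
    intro f
    obtain ⟨k, hk⟩ := Ultrafilter.eq_pure_of_finite (U.map f)
    refine ⟨k, ?_⟩
    have h : {k} ∈ U.map f := by rw [hk]; exact rfl
    exact h
  choose k hk using fun i => pigeon (c i)
  obtain ⟨k₀, hk₀⟩ := pigeon k
  obtain ⟨g, -, hg⟩ := exists_seq_of_forall_finset_exists (fun i => k i = k₀)
    (fun i j => i < j ∧ c i j = k₀) (by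
      intro s hs
      have h1 : ∀ᶠ j in (U : Filter ℕ), ∀ i ∈ s, i < j ∧ c i j = k₀ := by
        rw [Filter.eventually_all_finset]
        intro i hi
        have h2 : ∀ᶠ j in (U : Filter ℕ), i < j := by
          refine Filter.hyperfilter_le_cofinite ?_
          rw [Nat.cofinite_eq_atTop]
          exact Filter.eventually_gt_atTop i
        filter_upwards [h2, hk i] with j hj hc
        exact ⟨hj, hc.trans (hs i hi)⟩
      exact (hk₀.and h1).exists)
  exact ⟨g, fun i j h => (hg i j h).1, k₀, fun i j h => (hg i j h).2⟩

/-- A sequence that is exponential up to a polynomial factor grows at least exponentially. -/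
theorem growsAtLeastExponentially_of_two_pow_le {f : ℕ → ℕ} {d : ℕ} (hd : 0 < d) (h0 : 0 < f 0)
    (h : ∀ m r, r < d → 2 ^ m ≤ f (d * m + 1 + r) * (d * m + 1 + r) ^ d) :
    GrowsAtLeastExponentially f := by
  have hd' : (0 : ℝ) < d := by exact_mod_cast hd
  -- The square root of the true rate 2^(1/d): one factor `c ^ n` absorbs the polynomial n^d, the
  -- other remains.
  set c : ℝ := 2 ^ (1 / (2 * d) : ℝ) with hc
  have hc1 : 1 < c := Real.one_lt_rpow (by norm_num) (by positivity)
  have hc2 : c ^ (2 * d) = 2 := by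
    rw [hc, ← Real.rpow_natCast, ← Real.rpow_mul (by norm_num)]
    push_cast
    rw [one_div_mul_cancel (by positivity), Real.rpow_one]
  obtain ⟨K, hK⟩ := (tendsto_pow_const_div_const_pow_of_one_lt d hc1).bddAbove_range
  have hK' : ∀ n : ℕ, (n : ℝ) ^ d ≤ (max K 1) * c ^ n := fun n => by
    have h1 : (n : ℝ) ^ d / c ^ n ≤ K := hK ⟨n, rfl⟩
    rw [div_le_iff₀ (by positivity)] at h1
    exact h1.trans (by gcongr; exact le_max_left _ _)
  have hL : 1 ≤ max K 1 := le_max_right _ _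
  set L := max K 1
  refine ⟨1 / (2 * L), c, by positivity, hc1, fun n => ?_⟩
  rw [div_mul_eq_mul_div, one_mul, div_le_iff₀ (by positivity)]
  rcases Nat.eq_zero_or_pos n with rfl | hn
  · have : (1 : ℝ) ≤ f 0 := by exact_mod_cast h0
    nlinarith
  · have hdiv := Nat.div_add_mod (n - 1) d
    have hmod := Nat.mod_lt (n - 1) hd
    set m := (n - 1) / d
    set r := (n - 1) % d
    have hn' : d * m + 1 + r = n := by omega
    have h1 := h m r hmod
    rw [hn'] at h1
    have h1' : (2 : ℝ) ^ m ≤ f n * n ^ d := by exact_mod_cast h1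
    have h2 : c ^ n * c ^ n ≤ 2 * 2 ^ m := by
      calc c ^ n * c ^ n = c ^ (2 * n) := by ring
        _ ≤ c ^ ((2 * d) * (m + 1)) := by
          apply pow_le_pow_right₀ hc1.le
          have : n ≤ d * (m + 1) := by rw [mul_add]; omega
          nlinarith
        _ = 2 * 2 ^ m := by rw [pow_mul, hc2]; ring
    have hcn : 0 < c ^ n := by positivity
    refine le_of_mul_le_mul_right ?_ hcn
    have h3 := mul_le_mul_of_nonneg_left (hK' n) (Nat.cast_nonneg (α := ℝ) (f n))
    calc c ^ n * c ^ n ≤ 2 * (f n * n ^ d) := by linarith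
      _ ≤ f n * (2 * L) * c ^ n := by linarith

/-! ### Counting subtournaments by coding binary words -/

namespace Tournament

variable {V : Type u} (T : Tournament V)

theorem asymm {T : Tournament V} {a b : V} (h : T.Adj a b) : ¬ T.Adj b a := fun h' => by
  obtain rfl := T.antisymm a b h h'
  exact T.irrefl a h

theorem ne_of_adj {T : Tournament V} {a b : V} (h : T.Adj a b) : a ≠ b := by
  rintro rfl
  exact T.irrefl a h

theorem not_adj_iff {T : Tournament V} {a b : V} (h : a ≠ b) : ¬ T.Adj a b ↔ T.Adj b a :=
  ⟨fun h' => (T.complete a b h).resolve_left h', asymm⟩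

theorem eq_of_not_adj {T : Tournament V} {a b : V} (h : ¬ T.Adj a b) (h' : ¬ T.Adj b a) :
    a = b := by
  by_contra hne
  exact (T.complete a b hne).elim h h'

theorem profile_pos [Infinite V] (n : ℕ) : 0 < T.profile n := by
  have := T.finite_quotient_inducedSetoid n
  obtain ⟨s, hs⟩ := Infinite.exists_subset_card_eq V n
  have : Nonempty (Quotient (T.inducedSetoid n)) := ⟨Quotient.mk _ ⟨s, hs⟩⟩
  exact Nat.card_pos

/-- If words of length `m` can be coded by `T`-embedded structures on `d * m` labels, so that the
word is determined by the isomorphism type of the structure together with one distinguished vertex,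
then the growth of the profile is at least exponential. -/
theorem growsAtLeastExponentially_of_codes [Infinite V] {d : ℕ} (hd : 0 < d)
    (H : ∀ m : ℕ, ∃ (ι : Type) (_ : Fintype ι) (p : V) (g : (Fin m → Bool) → ι → V),
      Fintype.card ι = d * m ∧ (∀ w, Function.Injective (g w)) ∧ (∀ w i, g w i ≠ p) ∧
      ∀ w w' (σ : Equiv.Perm ι),
        (∀ i j, T.Adj (g w' (σ i)) (g w' (σ j)) ↔ T.Adj (g w i) (g w j)) →
        (∀ i, T.Adj p (g w' (σ i)) ↔ T.Adj p (g w i)) → w = w') :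
    GrowsAtLeastExponentially T.profile := by
  classical
  refine growsAtLeastExponentially_of_two_pow_le hd (T.profile_pos 0) fun m r hr => ?_
  obtain ⟨ι, _, p, g, hcard, hinj, hp, hcode⟩ := H m
  set N := d * m + 1 + r with hN
  have hpad : ∀ w, ∃ h : Fin r → V, Function.Injective h ∧ ∀ k, h k ≠ p ∧ ∀ i, h k ≠ g w i := by
    intro w
    have hfin : (insert p (Set.range (g w))).Finite := (Set.finite_range _).insert p
    have := hfin.infinite_compl.to_subtype
    obtain ⟨e⟩ : Nonempty (Fin r ↪ ((insert p (Set.range (g w)))ᶜ : Set V)) :=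
      ⟨(Fin.valEmbedding).trans (Infinite.natEmbedding _)⟩
    refine ⟨fun k => (e k).1, fun a b h => e.injective (Subtype.ext h), fun k => ?_⟩
    have := (e k).2
    simp only [Set.mem_compl_iff, Set.mem_insert_iff, Set.mem_range, not_or, not_exists] at this
    exact ⟨this.1, fun i h => this.2 i h.symm⟩
  choose h hhinj hh using hpad
  let G : (Fin m → Bool) → ι ⊕ Option (Fin r) → V := fun w =>
    Sum.elim (g w) (fun o => o.elim p (h w))
  have hG : ∀ w, Function.Injective (G w) := by
    intro w
    rintro (i | _ | k) (j | _ | l) hij <;> simp only [G, Sum.elim_inl, Sum.elim_inr,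
      Option.elim_none, Option.elim_some] at hij
    · rw [hinj w hij]
    · exact (hp w i hij).elim
    · exact ((hh w l).2 i hij.symm).elim
    · exact (hp w j hij.symm).elim
    · rfl
    · exact ((hh w l).1 hij.symm).elim
    · exact ((hh w k).2 j hij).elim
    · exact ((hh w k).1 hij).elim
    · rw [hhinj w hij]
  let A : (Fin m → Bool) → {s : Finset V // s.card = N} := fun w =>
    ⟨Finset.univ.map ⟨G w, hG w⟩, by simp [hcard, hN]; ring⟩
  let q : (Fin m → Bool) → Quotient (T.inducedSetoid N) := fun w => Quotient.mk _ (A w)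
  have hq : ∀ w, ∃ f : ι ⊕ Option (Fin r) → ((q w).out.1 : Set V), Function.Bijective f ∧
      ∀ x y, T.Adj (f x) (f y) ↔ T.Adj (G w x) (G w y) := by
    intro w
    obtain ⟨e⟩ : (T.inducedSetoid N).r (A w) (q w).out :=
      Setoid.symm' _ (Quotient.mk_out (A w))
    let k : ι ⊕ Option (Fin r) → ((A w).1 : Set V) := fun x => ⟨G w x, by simp [A]⟩
    have hk : Function.Bijective k := by
      refine ⟨fun x y hxy => hG w (congrArg Subtype.val hxy), ?_⟩
      rintro ⟨y, hy⟩
      obtain ⟨x, -, rfl⟩ := Finset.mem_map.1 (Finset.mem_coe.1 hy)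
      exact ⟨x, rfl⟩
    exact ⟨e ∘ k, e.bijective.comp hk, fun x y => e.map_rel_iff⟩
  choose f hf hfadj using hq
  let E : ∀ t : Quotient (T.inducedSetoid N), (t.out.1 : Set V) ≃ Fin N := fun t =>
    t.out.1.equivFinOfCardEq t.out.2
  -- The isomorphism type, together with the places of `p` and of the `r` padding vertices in its
  -- representative. There are at most N^(r+1) ≤ N^d such places, which is the polynomial loss.
  let code : (Fin m → Bool) → Quotient (T.inducedSetoid N) × (Option (Fin r) → Fin N) := fun w =>
    (q w, fun o => E (q w) (f w (Sum.inr o)))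
  have key : ∀ w w' (t : Quotient (T.inducedSetoid N)) (a b : ι ⊕ Option (Fin r) → (t.out.1 : Set V)),
      Function.Bijective a → Function.Bijective b → (∀ o, a (Sum.inr o) = b (Sum.inr o)) →
      (∀ x y, T.Adj (a x) (a y) ↔ T.Adj (G w x) (G w y)) →
      (∀ x y, T.Adj (b x) (b y) ↔ T.Adj (G w' x) (G w' y)) → w = w' := by
    intro w w' t a b ha hb hab hadj hbdj
    let τ : Equiv.Perm (ι ⊕ Option (Fin r)) :=
      (Equiv.ofBijective a ha).trans (Equiv.ofBijective b hb).symm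
    have hτ : ∀ x, b (τ x) = a x := fun x => (Equiv.ofBijective b hb).apply_symm_apply _
    have hτr : ∀ o, τ (Sum.inr o) = Sum.inr o := fun o => hb.1 (by rw [hτ, hab])
    have hτl : ∀ i, ∃ j, τ (Sum.inl i) = Sum.inl j := by
      intro i
      rcases hx : τ (Sum.inl i) with j | o
      · exact ⟨j, rfl⟩
      · rw [← hτr o] at hx
        exact (Sum.inl_ne_inr (τ.injective hx)).elim
    choose s hs using hτl
    have hsinj : Function.Injective s := fun i j hij =>
      Sum.inl_injective (τ.injective (by rw [hs, hs, hij]))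
    have hmain : ∀ x y, T.Adj (G w' (τ x)) (G w' (τ y)) ↔ T.Adj (G w x) (G w y) := by
      intro x y
      rw [← hbdj, hτ, hτ, hadj]
    refine hcode w w' (Equiv.ofBijective s (Finite.injective_iff_bijective.1 hsinj)) ?_ ?_
    · intro i j
      have := hmain (Sum.inl i) (Sum.inl j)
      rwa [hs, hs] at this
    · intro i
      have := hmain (Sum.inr none) (Sum.inl i)
      rwa [hs, hτr] at this
  have hcodeinj : Function.Injective code := by
    intro w w' hww
    have h1 : q w = q w' := congrArg Prod.fst hww
    have h2 : ∀ o, E (q w) (f w (Sum.inr o)) = E (q w') (f w' (Sum.inr o)) :=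
      fun o => congrFun (congrArg Prod.snd hww) o
    have gen : ∀ t t' (a : ι ⊕ Option (Fin r) → (t.out.1 : Set V))
        (b : ι ⊕ Option (Fin r) → (t'.out.1 : Set V)), t = t' →
        Function.Bijective a → Function.Bijective b →
        (∀ o, E t (a (Sum.inr o)) = E t' (b (Sum.inr o))) →
        (∀ x y, T.Adj (a x) (a y) ↔ T.Adj (G w x) (G w y)) →
        (∀ x y, T.Adj (b x) (b y) ↔ T.Adj (G w' x) (G w' y)) → w = w' := by
      rintro t _ a b rfl ha hb hab
      exact key w w' t a b ha hb fun o => (E t).injective (hab o)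
    exact gen _ _ _ _ h1 (hf w) (hf w') h2 (hfadj w) (hfadj w')
  have := T.finite_quotient_inducedSetoid N
  have hle := Nat.card_le_card_of_injective code hcodeinj
  simp only [Nat.card_eq_fintype_card, Fintype.card_fun, Fintype.card_bool, Fintype.card_fin,
    Nat.card_prod, Fintype.card_option] at hle
  refine hle.trans (Nat.mul_le_mul le_rfl ?_)
  exact Nat.pow_le_pow_right (by omega) (by omega)

end Tournament
-- Three configurations that force exponential growth
namespace Tournament

variable {V : Type u} (T : Tournament V)

/-- A version of `growsAtLeastExponentially_of_codes` in which the labels carry a linear order that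
is definable from the edges and from the distinguished vertex. -/
theorem growsAtLeastExponentially_of_ordered_codes [Infinite V] {d : ℕ} (hd : 0 < d)
    (ρ : Prop → Prop → Prop → Prop → Prop)
    (H : ∀ m : ℕ, ∃ (ι : Type) (_ : Fintype ι) (_ : LinearOrder ι) (p : V)
      (g : (Fin m → Bool) → ι → V), Fintype.card ι = d * m ∧ (∀ w i, g w i ≠ p) ∧
      (∀ w i j, i < j ↔ ρ (T.Adj (g w i) (g w j)) (T.Adj (g w j) (g w i))
        (T.Adj p (g w i)) (T.Adj p (g w j))) ∧
      ∀ w w', (∀ i j, T.Adj (g w' i) (g w' j) ↔ T.Adj (g w i) (g w j)) →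
        (∀ i, T.Adj p (g w' i) ↔ T.Adj p (g w i)) → w = w') :
    GrowsAtLeastExponentially T.profile := by
  refine T.growsAtLeastExponentially_of_codes hd fun m => ?_
  obtain ⟨ι, _, _, p, g, hcard, hp, hρ, hcode⟩ := H m
  refine ⟨ι, inferInstance, p, g, hcard, ?_, hp, ?_⟩
  · intro w i j hij
    by_contra hne
    have h1 := hρ w i j
    have h2 := hρ w j i
    rw [hij] at h1 h2
    rcases lt_or_gt_of_ne hne with h | h
    · exact lt_asymm h (h2.2 (h1.1 h))
    · exact lt_asymm h (h1.2 (h2.1 h))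
  · intro w w' σ hσ hσp
    -- A permutation that respects the definable order is an automorphism of a finite linear order,
    -- hence the identity.
    have hmono : StrictMono σ := by
      intro i j hij
      rw [hρ w', hσ, hσ, hσp, hσp]
      exact (hρ w i j).1 hij
    have hid : ∀ i, σ i = i := by
      intro i
      have : (hmono.orderIsoOfSurjective σ σ.surjective) = OrderIso.refl ι :=
        Subsingleton.elim _ _
      exact congrFun (congrArg DFunLike.coe this) i
    simp only [hid] at hσ hσp
    exact hcode w w' hσ hσp

/-- The sequence `s` is a chain, increasing or decreasing. -/
def IsChainSeq (s : ℕ → V) : Prop :=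
  (∀ i j, i < j → T.Adj (s i) (s j)) ∨ ∀ i j, i < j → T.Adj (s j) (s i)

variable {T}

/-- Keeping the direction as a proposition lets increasing and decreasing chains share one argument.
-/
theorem IsChainSeq.exists_dir {s : ℕ → V} (hs : T.IsChainSeq s) :
    ∃ P : Prop, ∀ i j, i < j → ((T.Adj (s i) (s j) ↔ P) ∧ (T.Adj (s j) (s i) ↔ ¬ P)) := by
  rcases hs with hs | hs
  · exact ⟨True, fun i j h => by simp [hs i j h, asymm (hs i j h)]⟩
  · exact ⟨False, fun i j h => by simp [hs i j h, asymm (hs i j h)]⟩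

theorem infinite_of_isChainSeq {s : ℕ → V} (hs : T.IsChainSeq s) : Infinite V := by
  refine Infinite.of_injective s fun i j hij => ?_
  by_contra hne
  rcases hs with hs | hs <;> rcases lt_or_gt_of_ne hne with h | h <;>
  · have := hs _ _ h
    rw [hij] at this
    exact T.irrefl _ this

/-- Two interleaved chains that are separated by a vertex give exponential growth. -/
theorem growsAtLeastExponentially_of_crossing {s t : ℕ → V} (hs : T.IsChainSeq s)
    (ht : T.IsChainSeq t)
    (hst : (∀ i j, i < j → T.Adj (s i) (t j) ∧ T.Adj (t i) (s j)) ∨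
      ∀ i j, i < j → T.Adj (t j) (s i) ∧ T.Adj (s j) (t i))
    (hv : ∀ m, ∃ k p, ∀ i, k ≤ i → i < k + m → T.Adj p (s i) ∧ T.Adj (t i) p) :
    GrowsAtLeastExponentially T.profile := by
  have := infinite_of_isChainSeq hs
  obtain ⟨P, hP⟩ := hs.exists_dir
  obtain ⟨Q, hQ⟩ := ht.exists_dir
  obtain ⟨R, hR⟩ : ∃ R : Prop, ∀ i j, i < j → ((T.Adj (s i) (t j) ↔ R) ∧ (T.Adj (t i) (s j) ↔ R)) ∧
      (T.Adj (s j) (t i) ↔ ¬ R) ∧ (T.Adj (t j) (s i) ↔ ¬ R) := by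
    rcases hst with h | h
    · exact ⟨True, fun i j hij => by
        simp [h i j hij, asymm (h i j hij).1, asymm (h i j hij).2]⟩
    · exact ⟨False, fun i j hij => by
        simp [h i j hij, asymm (h i j hij).1, asymm (h i j hij).2]⟩
  -- Whether the edge points from the smaller index to the larger, given which chain each end is in.
  -- `D` is symmetric and `p` reveals the chain, so the index order is definable.
  let D : Prop → Prop → Prop := fun α β => (α ∧ β ∧ P) ∨ (¬ α ∧ ¬ β ∧ Q) ∨ (¬ (α ↔ β) ∧ R)
  refine T.growsAtLeastExponentially_of_ordered_codes (d := 1) one_pos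
    (fun x y α β => (D α β ∧ x) ∨ (¬ D α β ∧ y)) fun m => ?_
  obtain ⟨k, p, hp⟩ := hv m
  let g : (Fin m → Bool) → Fin m → V := fun w i => if w i then s (k + i) else t (k + i)
  have hpi : ∀ i : Fin m, T.Adj p (s (k + i)) ∧ T.Adj (t (k + i)) p := fun i =>
    hp (k + i) (by omega) (by omega)
  have hpg : ∀ w i, T.Adj p (g w i) ↔ w i = true := by
    intro w i
    by_cases h : w i <;> simp [g, h, (hpi i).1, asymm (hpi i).2]
  have hlt : ∀ w (i j : Fin m), i < j → ((T.Adj (g w i) (g w j) ↔ D (w i = true) (w j = true)) ∧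
      (T.Adj (g w j) (g w i) ↔ ¬ D (w i = true) (w j = true))) := by
    intro w i j hij
    have hij' : k + (i : ℕ) < k + j := by simpa using hij
    have h1 := hP _ _ hij'
    have h2 := hQ _ _ hij'
    have h3 := hR _ _ hij'
    by_cases hi : w i <;> by_cases hj : w j <;> simp [g, hi, hj, D, h1, h2, h3]
  have hDsymm : ∀ α β, D α β ↔ D β α := by
    intro α β
    simp only [D]
    tauto
  refine ⟨Fin m, inferInstance, inferInstance, p, g, by simp, ?_, ?_, ?_⟩
  · intro w i h
    by_cases hi : w i <;> simp only [g, hi, if_true] at h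
    · exact ne_of_adj (hpi i).1 h.symm
    · exact ne_of_adj (hpi i).2 h
  · intro w i j
    rcases lt_trichotomy i j with h | rfl | h
    · have := hlt w i j h
      simp only [hpg, this, h, true_iff]
      by_cases hD : D (w i = true) (w j = true)
      · exact Or.inl ⟨hD, hD⟩
      · exact Or.inr ⟨hD, hD⟩
    · simp [T.irrefl]
    · have := hlt w j i h
      simp only [hpg, this, not_lt_of_gt h, false_iff, hDsymm (w i = true) (w j = true)]
      rintro (hD | hD)
      · exact hD.2 hD.1
      · exact hD.1 hD.2
  · intro w w' _ h
    funext i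
    have := h i
    rw [hpg, hpg] at this
    exact (Bool.eq_iff_iff.2 this).symm

/-- Two chains, one dominating the other up to a perfect matching, and separated by a vertex, give
exponential growth. -/
theorem growsAtLeastExponentially_of_matching {z u : ℕ → V} (hz : T.IsChainSeq z)
    (hu : T.IsChainSeq u) (huz : ∀ i j, i ≠ j → T.Adj (u i) (z j))
    (hzu : ∀ i, T.Adj (z i) (u i))
    (hv : ∀ m, ∃ k p, ∀ i, k ≤ i → i < k + m → T.Adj p (z i) ∧ T.Adj (u i) p) :
    GrowsAtLeastExponentially T.profile := by
  have := infinite_of_isChainSeq hz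
  obtain ⟨P, hP⟩ := hz.exists_dir
  obtain ⟨Q, hQ⟩ := hu.exists_dir
  refine T.growsAtLeastExponentially_of_ordered_codes (d := 2) two_pos
    (fun x y α β => (α ∧ ¬ β) ∨ (α ∧ β ∧ ((P ∧ x) ∨ (¬ P ∧ y))) ∨
      (¬ α ∧ ¬ β ∧ ((Q ∧ x) ∨ (¬ Q ∧ y)))) fun m => ?_
  obtain ⟨k, p, hp⟩ := hv (2 * m)
  -- The i-th vertex of `u` is the partner of `z (k + 2 * i)` if the letter is true, and otherwise
  -- has the unused odd index after it. The matching edge reads off the letter.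
  let c : (Fin m → Bool) → Fin m → ℕ := fun w i => k + 2 * i + if w i then 0 else 1
  have hc : ∀ w (i j : Fin m), i < j → c w i < c w j := by
    intro w i j hij
    have : (i : ℕ) < j := hij
    simp only [c]
    split_ifs <;> omega
  have hcm : ∀ w i, k ≤ c w i ∧ c w i < k + 2 * m := by
    intro w i
    have := i.2
    simp only [c]
    split_ifs <;> omega
  let g : (Fin m → Bool) → Fin m ⊕ₗ Fin m → V := fun w x =>
    Sum.elim (fun i : Fin m => z (k + 2 * i)) (fun i => u (c w i)) (ofLex x)
  have hgl : ∀ w i, g w (Sum.inlₗ i) = z (k + 2 * i) := fun w i => rfl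
  have hgr : ∀ w i, g w (Sum.inrₗ i) = u (c w i) := fun w i => rfl
  have hpl : ∀ w i, T.Adj p (g w (Sum.inlₗ i)) := fun w i =>
    (hp _ (by omega) (by have := i.2; omega)).1
  have hpr : ∀ w i, T.Adj (g w (Sum.inrₗ i)) p := fun w i => (hp _ (hcm w i).1 (hcm w i).2).2
  refine ⟨Fin m ⊕ₗ Fin m, inferInstanceAs (Fintype (Fin m ⊕ Fin m)), inferInstance, p, g,
    ?_, ?_, ?_, ?_⟩
  · exact (Fintype.card_sum).trans (by simp [two_mul])
  · intro w x
    induction x using Lex.rec with | _ x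
    rcases x with i | i
    · exact (ne_of_adj (hpl w i)).symm
    · exact ne_of_adj (hpr w i)
  · intro w x y
    induction x using Lex.rec with | _ x
    induction y using Lex.rec with | _ y
    have hpr' : ∀ i, ¬ T.Adj p (g w (Sum.inrₗ i)) := fun i => asymm (hpr w i)
    rcases x with i | i <;> rcases y with j | j
    · change Sum.inlₗ i < Sum.inlₗ j ↔ _
      have e1 := hpl w i
      have e2 := hpl w j
      change _ ↔ (T.Adj p (g w (Sum.inlₗ i)) ∧ ¬ T.Adj p (g w (Sum.inlₗ j))) ∨
        (T.Adj p (g w (Sum.inlₗ i)) ∧ T.Adj p (g w (Sum.inlₗ j)) ∧ _) ∨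
        (¬ T.Adj p (g w (Sum.inlₗ i)) ∧ _)
      simp only [e1, e2, not_true, true_and, false_and, false_or, or_false]
      rw [Sum.Lex.inl_lt_inl_iff]
      rcases lt_trichotomy i j with h | rfl | h
      · have h' : (i : ℕ) < j := h
        have := hP (k + 2 * i) (k + 2 * j) (by omega)
        change _ ↔ (P ∧ T.Adj (z (k + 2 * i)) (z (k + 2 * j))) ∨
          (¬ P ∧ T.Adj (z (k + 2 * j)) (z (k + 2 * i)))
        simp only [this, h, true_iff]
        tauto
      · change _ ↔ (P ∧ T.Adj (z (k + 2 * i)) (z (k + 2 * i))) ∨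
          (¬ P ∧ T.Adj (z (k + 2 * i)) (z (k + 2 * i)))
        simp [T.irrefl]
      · have h' : (j : ℕ) < i := h
        have := hP (k + 2 * j) (k + 2 * i) (by omega)
        change _ ↔ (P ∧ T.Adj (z (k + 2 * i)) (z (k + 2 * j))) ∨
          (¬ P ∧ T.Adj (z (k + 2 * j)) (z (k + 2 * i)))
        simp only [this, not_lt_of_gt h, false_iff]
        tauto
    · exact iff_of_true (Sum.Lex.inl_lt_inr _ _) (Or.inl ⟨hpl w i, hpr' j⟩)
    · refine iff_of_false (fun h => lt_asymm h (Sum.Lex.inl_lt_inr _ _)) ?_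
      have e1 := hpr' i
      have e2 := hpl w j
      rintro (h | h | h)
      · exact e1 h.1
      · exact e1 h.1
      · exact h.2.1 e2
    · change Sum.inrₗ i < Sum.inrₗ j ↔ _
      have e1 := hpr' i
      have e2 := hpr' j
      change _ ↔ (T.Adj p (g w (Sum.inrₗ i)) ∧ _) ∨
        (T.Adj p (g w (Sum.inrₗ i)) ∧ _) ∨
        (¬ T.Adj p (g w (Sum.inrₗ i)) ∧ ¬ T.Adj p (g w (Sum.inrₗ j)) ∧ _)
      simp only [e1, e2, not_false_iff, true_and, false_and, false_or]
      rw [Sum.Lex.inr_lt_inr_iff]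
      rcases lt_trichotomy i j with h | rfl | h
      · have := hQ _ _ (hc w i j h)
        change _ ↔ (Q ∧ T.Adj (u (c w i)) (u (c w j))) ∨ (¬ Q ∧ T.Adj (u (c w j)) (u (c w i)))
        simp only [this, h, true_iff]
        tauto
      · change _ ↔ (Q ∧ T.Adj (u (c w i)) (u (c w i))) ∨ (¬ Q ∧ T.Adj (u (c w i)) (u (c w i)))
        simp [T.irrefl]
      · have := hQ _ _ (hc w j i h)
        change _ ↔ (Q ∧ T.Adj (u (c w i)) (u (c w j))) ∨ (¬ Q ∧ T.Adj (u (c w j)) (u (c w i)))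
        simp only [this, not_lt_of_gt h, false_iff]
        tauto
  · intro w w' h _
    have hw : ∀ w i, T.Adj (g w (Sum.inlₗ i)) (g w (Sum.inrₗ i)) ↔ w i = true := by
      intro w i
      rw [hgl, hgr]
      by_cases hi : w i
      · simp [c, hi, hzu]
      · simp only [c, hi]
        exact iff_of_false (asymm (huz _ _ (by simp))) (by simp)
    funext i
    have := h (Sum.inlₗ i) (Sum.inrₗ i)
    rw [hw, hw] at this
    exact (Bool.eq_iff_iff.2 this).symm

/-- An infinite ordered sum of 3-cycles gives exponential growth. -/
theorem growsAtLeastExponentially_of_sum_cycles {b : ℕ → Fin 3 → V}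
    (hb : ∀ i j, i < j → ∀ s t, T.Adj (b i s) (b j t))
    (hb01 : ∀ i, T.Adj (b i 0) (b i 1)) (hb12 : ∀ i, T.Adj (b i 1) (b i 2))
    (hb20 : ∀ i, T.Adj (b i 2) (b i 0)) : GrowsAtLeastExponentially T.profile := by
  classical
  have := infinite_of_isChainSeq (s := fun i => b i 0) (Or.inl fun i j h => hb i j h 0 0)
  refine T.growsAtLeastExponentially_of_codes (d := 3) three_pos fun m => ?_
  -- A true letter is a 3-cycle. For a false letter the third vertex comes from the next block,
  -- giving a transitive triple. Block 0 is left for the distinguished vertex.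
  let g : (Fin m → Bool) → Fin m × Fin 3 → V := fun w x =>
    if w x.1 = false ∧ x.2 = 2 then b (2 * x.1 + 2) 0 else b (2 * x.1 + 1) x.2
  have hg : ∀ w x, ∃ k t, 2 * (x.1 : ℕ) + 1 ≤ k ∧ k ≤ 2 * x.1 + 2 ∧ g w x = b k t := by
    intro w x
    simp only [g]
    split_ifs
    · exact ⟨_, _, by omega, le_rfl, rfl⟩
    · exact ⟨_, _, le_rfl, by omega, rfl⟩
  have hlt : ∀ w (x y : Fin m × Fin 3), x.1 < y.1 → T.Adj (g w x) (g w y) := by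
    intro w x y hxy
    obtain ⟨k, t, -, hk, e⟩ := hg w x
    obtain ⟨k', t', hk', -, e'⟩ := hg w y
    rw [e, e']
    have : (x.1 : ℕ) < y.1 := hxy
    exact hb _ _ (by omega) _ _
  have hcyc : ∀ w i, w i = true → ∀ a, ∃ c, T.Adj (g w (i, a)) (g w (i, c)) := by
    intro w i hi a
    fin_cases a
    · exact ⟨1, by simpa [g, hi] using hb01 _⟩
    · exact ⟨2, by simpa [g, hi] using hb12 _⟩
    · exact ⟨0, by simpa [g, hi] using hb20 _⟩
  have hchain : ∀ w i, w i = false → ∀ c, ¬ T.Adj (g w (i, 2)) (g w (i, c)) := by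
    intro w i hi c
    fin_cases c
    · exact asymm (by simpa [g, hi] using hb _ _ (by omega) _ _)
    · exact asymm (by simpa [g, hi] using hb _ _ (by omega) _ _)
    · exact T.irrefl _
  have hne : ∀ w i a c, a ≠ c → g w (i, a) ≠ g w (i, c) := by
    have hlt1 : ∀ w i, T.Adj (g w (i, 0)) (g w (i, 1)) := by
      intro w i
      simpa [g] using hb01 _
    have hlt2 : ∀ w i, T.Adj (g w (i, 1)) (g w (i, 2)) := by
      intro w i
      by_cases hi : w i
      · simpa [g, hi] using hb12 _
      · simpa [g, hi] using hb _ _ (by omega) _ _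
    have hlt3 : ∀ w i, g w (i, 0) ≠ g w (i, 2) := by
      intro w i
      by_cases hi : w i
      · simpa [g, hi] using (ne_of_adj (hb20 _)).symm
      · simpa [g, hi] using ne_of_adj (hb _ _ (by omega) _ _)
    intro w i a c hac
    fin_cases a <;> fin_cases c <;> first
      | exact (hac rfl).elim
      | exact ne_of_adj (hlt1 w i)
      | exact (ne_of_adj (hlt1 w i)).symm
      | exact ne_of_adj (hlt2 w i)
      | exact (ne_of_adj (hlt2 w i)).symm
      | exact hlt3 w i
      | exact (hlt3 w i).symm
  refine ⟨Fin m × Fin 3, inferInstance, b 0 0, g, by simp [mul_comm], ?_, ?_, ?_⟩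
  · rintro w ⟨i, a⟩ ⟨j, c⟩ h
    rcases lt_trichotomy i j with hij | rfl | hij
    · exact (ne_of_adj (hlt w (i, a) (j, c) hij) h).elim
    · by_contra hac
      exact hne w i a c (fun e => hac (by rw [e])) h
    · exact (ne_of_adj (hlt w (j, c) (i, a) hij) h.symm).elim
  · intro w x
    obtain ⟨k, t, hk, -, e⟩ := hg w x
    rw [e]
    exact (ne_of_adj (hb _ _ (by omega) _ _)).symm
  · intro w w' σ hσ _
    -- The out-degree of a vertex of triple i lies in [3(m-1-i), 3(m-i)). These intervals are
    -- disjoint, so `σ` preserves each triple.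
    let out : (Fin m → Bool) → Fin m × Fin 3 → Finset (Fin m × Fin 3) := fun w x =>
      Finset.univ.filter fun y => T.Adj (g w x) (g w y)
    have hout : ∀ x, (out w' (σ x)).card = (out w x).card := by
      intro x
      refine (Finset.card_equiv σ fun y => ?_).symm
      simp only [out, Finset.mem_filter, Finset.mem_univ, true_and, hσ]
    have hlow : ∀ w x, (m - 1 - (x.1 : ℕ)) * 3 ≤ (out w x).card := by
      intro w x
      have h1 : Finset.Ioi x.1 ×ˢ (Finset.univ : Finset (Fin 3)) ⊆ out w x := by
        intro y hy
        simp only [Finset.mem_product, Finset.mem_Ioi] at hy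
        simpa [out] using hlt w x y hy.1
      simpa using Finset.card_le_card h1
    have hup : ∀ w x, (out w x).card + 1 ≤ (m - (x.1 : ℕ)) * 3 := by
      intro w x
      have h1 : insert x (out w x) ⊆ Finset.Ici x.1 ×ˢ (Finset.univ : Finset (Fin 3)) := by
        intro y hy
        simp only [Finset.mem_product, Finset.mem_Ici, Finset.mem_univ, and_true]
        rcases Finset.mem_insert.1 hy with rfl | hy
        · exact le_rfl
        · by_contra hlt'
          exact asymm (hlt w y x (not_le.1 hlt')) (by simpa [out] using hy)
      have h2 := Finset.card_le_card h1
      rw [Finset.card_insert_of_notMem (by simp [out, T.irrefl])] at h2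
      simpa using h2
    have hblock : ∀ x, (σ x).1 = x.1 := by
      intro x
      have h1 := hlow w x
      have h2 := hup w x
      have h3 := hlow w' (σ x)
      have h4 := hup w' (σ x)
      rw [hout] at h3 h4
      have := x.1.2
      have := (σ x).1.2
      apply Fin.ext
      omega
    have hstep : ∀ i, ¬ (w i = true ∧ w' i = false) := by
      rintro i ⟨hi, hi'⟩
      obtain ⟨⟨j, a⟩, hx⟩ := σ.surjective (i, 2)
      have hj : j = i := by
        have := hblock (j, a)
        rw [hx] at this
        exact this.symm
      subst hj
      obtain ⟨c, hc⟩ := hcyc w j hi a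
      rw [← hσ, hx] at hc
      have h5 : σ (j, c) = (j, (σ (j, c)).2) := Prod.ext (hblock (j, c)) rfl
      rw [h5] at hc
      exact hchain w' j hi' _ hc
    have hstep' : ∀ i, ¬ (w' i = true ∧ w i = false) := by
      rintro i ⟨hi, hi'⟩
      have hx := hblock (i, 2)
      have h5 : σ (i, 2) = (i, (σ (i, 2)).2) := Prod.ext hx rfl
      obtain ⟨c, hc⟩ := hcyc w' i hi (σ (i, 2)).2
      rw [← h5, ← σ.apply_symm_apply (i, c), hσ] at hc
      have h6 : (σ.symm (i, c)).1 = i := by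
        have := hblock (σ.symm (i, c))
        rw [σ.apply_symm_apply] at this
        exact this.symm
      have h7 : σ.symm (i, c) = (i, (σ.symm (i, c)).2) := Prod.ext h6 rfl
      rw [h7] at hc
      exact hchain w i hi' _ hc
    funext i
    have h1 := hstep i
    have h2 := hstep' i
    cases h3 : w i <;> cases h4 : w' i <;> simp_all

end Tournament
-- Uniform sequences of blocks
namespace Tournament

variable {V : Type u} {S : Type v} {T : Tournament V} {b : ℕ → S → V} {fwd bwd dia : S → S → Prop}

/-- The edges between `b i s` and `b j t` depend only on `s`, `t` and on the order of `i`, `j`. -/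
structure IsUniform (T : Tournament V) (b : ℕ → S → V) (fwd bwd dia : S → S → Prop) : Prop where
  adj_fwd : ∀ {i j : ℕ} (s t : S), i < j → (T.Adj (b i s) (b j t) ↔ fwd s t)
  adj_bwd : ∀ {i j : ℕ} (s t : S), i < j → (T.Adj (b j s) (b i t) ↔ bwd s t)
  adj_dia : ∀ (i : ℕ) (s t : S), T.Adj (b i s) (b i t) ↔ dia s t

namespace IsUniform

theorem isChainSeq (h : T.IsUniform b fwd bwd dia) {s : S} (hs : fwd s s ∨ bwd s s) :
    T.IsChainSeq fun i => b i s :=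
  hs.imp (fun hs _ _ hij => (h.adj_fwd s s hij).2 hs) (fun hs _ _ hij => (h.adj_bwd s s hij).2 hs)

/-- Blocks may share vertices, so a label need not give a chain; the alternative is that it is
constant. -/
theorem eq_of_const (h : T.IsUniform b fwd bwd dia) {s : S} (hs : ¬ (fwd s s ∨ bwd s s))
    {i j : ℕ} (hij : i < j) : b i s = b j s :=
  eq_of_not_adj (fun h' => hs (Or.inl ((h.adj_fwd s s hij).1 h')))
    (fun h' => hs (Or.inr ((h.adj_bwd s s hij).1 h')))

/-- Otherwise `b 0 u` would equal every later `b j y`, but these are distinct. -/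
theorem fwd_or_bwd (h : T.IsUniform b fwd bwd dia) {u y : S} (hy : fwd y y) :
    fwd u y ∨ bwd y u := by
  by_contra hcon
  have key : ∀ j, 0 < j → b 0 u = b j y := fun j hj =>
    eq_of_not_adj (fun h' => hcon (Or.inl ((h.adj_fwd u y hj).1 h')))
      (fun h' => hcon (Or.inr ((h.adj_bwd y u hj).1 h')))
  exact ne_of_adj ((h.adj_fwd y y one_lt_two).2 hy) ((key 1 one_pos).symm.trans (key 2 two_pos))

theorem bwd_or_fwd (h : T.IsUniform b fwd bwd dia) {u y : S} (hy : fwd y y) :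
    bwd u y ∨ fwd y u := by
  by_contra hcon
  have key : ∀ i, i < 2 → b i y = b 2 u := fun i hi =>
    eq_of_not_adj (fun h' => hcon (Or.inr ((h.adj_fwd y u hi).1 h')))
      (fun h' => hcon (Or.inl ((h.adj_bwd u y hi).1 h')))
  exact ne_of_adj ((h.adj_fwd y y zero_lt_one).2 hy)
    ((key 0 two_pos).trans (key 1 one_lt_two).symm)

theorem grows_of_separating_first (h : T.IsUniform b fwd bwd dia) {s t u : S}
    (hs : fwd s s ∨ bwd s s) (ht : fwd t t ∨ bwd t t)
    (hst : (fwd s t ∧ fwd t s) ∨ (bwd t s ∧ bwd s t)) (hus : fwd u s) (htu : bwd t u) :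
    GrowsAtLeastExponentially T.profile := by
  refine growsAtLeastExponentially_of_crossing (h.isChainSeq hs) (h.isChainSeq ht) ?_ fun m =>
    ⟨1, b 0 u, fun i hi _ => ⟨(h.adj_fwd u s hi).2 hus, (h.adj_bwd t u hi).2 htu⟩⟩
  exact hst.imp
    (fun hst i j hij => ⟨(h.adj_fwd s t hij).2 hst.1, (h.adj_fwd t s hij).2 hst.2⟩)
    (fun hst i j hij => ⟨(h.adj_bwd t s hij).2 hst.1, (h.adj_bwd s t hij).2 hst.2⟩)

/-- Here the separating vertex comes after the window and so depends on its length, which is why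
`growsAtLeastExponentially_of_crossing` asks only for windows. -/
theorem grows_of_separating_last (h : T.IsUniform b fwd bwd dia) {s t u : S}
    (hs : fwd s s ∨ bwd s s) (ht : fwd t t ∨ bwd t t)
    (hst : (fwd s t ∧ fwd t s) ∨ (bwd t s ∧ bwd s t)) (hus : bwd u s) (htu : fwd t u) :
    GrowsAtLeastExponentially T.profile := by
  refine growsAtLeastExponentially_of_crossing (h.isChainSeq hs) (h.isChainSeq ht) ?_ fun m =>
    ⟨0, b (0 + m) u, fun i _ hi => ⟨(h.adj_bwd u s hi).2 hus, (h.adj_fwd t u hi).2 htu⟩⟩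
  exact hst.imp
    (fun hst i j hij => ⟨(h.adj_fwd s t hij).2 hst.1, (h.adj_fwd t s hij).2 hst.2⟩)
    (fun hst i j hij => ⟨(h.adj_bwd t s hij).2 hst.1, (h.adj_bwd s t hij).2 hst.2⟩)

variable (hexp : ¬ GrowsAtLeastExponentially T.profile)
include hexp

/-- If `s` decreased, `b 0 s` would separate the later `x` from the later `s`; if it were constant,
its vertex would both dominate and be dominated by `b 1 x`. -/
theorem fwd_self_of_merged (h : T.IsUniform b fwd bwd dia) {x s : S} (hx : fwd x x)
    (hxs : fwd x s) (hsx : fwd s x) : fwd s s := by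
  by_contra hss
  by_cases hb : bwd s s
  · exact hexp (h.grows_of_separating_first (Or.inl hx) (Or.inr hb) (Or.inl ⟨hxs, hsx⟩) hsx hb)
  · have e := h.eq_of_const (not_or.2 ⟨hss, hb⟩) two_pos
    have h1 := (h.adj_fwd s x zero_lt_one).2 hsx
    have h2 := (h.adj_fwd x s one_lt_two).2 hxs
    rw [← e] at h2
    exact asymm h1 h2

/-- A `u` treating merged labels differently would separate two crossing chains. -/
theorem fwd_congr (h : T.IsUniform b fwd bwd dia) {x y u : S} (hx : fwd x x) (hy : fwd y y)
    (hxy : fwd x y) (hyx : fwd y x) (hux : fwd u x) : fwd u y :=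
  (h.fwd_or_bwd hy).resolve_right fun hyu => hexp
    (h.grows_of_separating_first (Or.inl hx) (Or.inl hy) (Or.inl ⟨hxy, hyx⟩) hux hyu)

theorem bwd_congr (h : T.IsUniform b fwd bwd dia) {x y u : S} (hx : fwd x x) (hy : fwd y y)
    (hxy : fwd x y) (hyx : fwd y x) (hux : bwd u x) : bwd u y :=
  (h.bwd_or_fwd hy).resolve_right fun hyu => hexp
    (h.grows_of_separating_last (Or.inl hx) (Or.inl hy) (Or.inl ⟨hxy, hyx⟩) hux hyu)

/-- If `u` dominates `x` in both directions, it also dominates `z` in all other blocks, against z →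
u inside a block: a matching. If `u` dominates `x` in neither direction, u → z' gives a matching
with the roles exchanged. If all edges between `u` and `x` go backwards, `b 0 x` separates the two
chains. The remaining case is merging. -/
theorem merged_of_dia (h : T.IsUniform b fwd bwd dia) {x z z' u : S} (hx : fwd x x)
    (hz : fwd x z ∧ fwd z x) (hz' : fwd x z' ∧ fwd z' x) (hzu : dia z u) (huz' : dia u z') :
    fwd x u ∧ fwd u x := by
  have hzz := h.fwd_self_of_merged hexp hx hz.1 hz.2
  have hzz' := h.fwd_self_of_merged hexp hx hz'.1 hz'.2
  by_cases hf : fwd u x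
  · by_cases hb : bwd u x
    · exfalso
      have hfz := h.fwd_congr hexp hx hzz hz.1 hz.2 hf
      have hbz := h.bwd_congr hexp hx hzz hz.1 hz.2 hb
      have hu : fwd u u ∨ bwd u u := by
        by_contra hu
        have h1 := (h.adj_fwd u z zero_lt_one).2 hfz
        rw [h.eq_of_const hu zero_lt_one] at h1
        exact asymm h1 ((h.adj_dia 1 z u).2 hzu)
      refine hexp (growsAtLeastExponentially_of_matching (h.isChainSeq (Or.inl hzz))
        (h.isChainSeq hu) ?_ (fun i => (h.adj_dia i z u).2 hzu) fun m =>
        ⟨1, b 0 z, fun i hi _ => ⟨(h.adj_fwd z z hi).2 hzz, (h.adj_bwd u z hi).2 hbz⟩⟩)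
      intro i j hij
      rcases lt_or_gt_of_ne hij with hij | hij
      · exact (h.adj_fwd u z hij).2 hfz
      · exact (h.adj_bwd u z hij).2 hbz
    · exact ⟨(h.bwd_or_fwd hx).resolve_left hb, hf⟩
  · exfalso
    by_cases hb : bwd u x
    · have hxu := (h.fwd_or_bwd hx).resolve_left hf
      have hu : fwd u u ∨ bwd u u := by
        by_contra hu
        have h1 := (h.adj_bwd u x one_lt_two).2 hb
        rw [← h.eq_of_const hu two_pos] at h1
        exact hf ((h.adj_fwd u x zero_lt_one).1 h1)
      exact hexp (h.grows_of_separating_first (Or.inl hx) hu (Or.inr ⟨hb, hxu⟩) hx hb)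
    · have hfz : ¬ fwd u z' := fun hfz => hf (h.fwd_congr hexp hzz' hx hz'.2 hz'.1 hfz)
      have hbz : ¬ bwd u z' := fun hbz => hb (h.bwd_congr hexp hzz' hx hz'.2 hz'.1 hbz)
      have hbz' := (h.fwd_or_bwd hzz').resolve_left hfz
      have hfz' := (h.bwd_or_fwd hzz').resolve_left hbz
      have hu : fwd u u ∨ bwd u u := by
        by_contra hu
        have h1 := (h.adj_fwd z' u zero_lt_one).2 hfz'
        rw [← h.eq_of_const hu zero_lt_one] at h1
        exact asymm h1 ((h.adj_dia 0 u z').2 huz')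
      refine hexp (growsAtLeastExponentially_of_matching (h.isChainSeq hu)
        (h.isChainSeq (Or.inl hzz')) ?_ (fun i => (h.adj_dia i u z').2 huz') fun m =>
        ⟨0, b (0 + m) z', fun i _ hi =>
          ⟨(h.adj_bwd z' u hi).2 hbz', (h.adj_fwd z' z' hi).2 hzz'⟩⟩)
      intro i j hij
      rcases lt_or_gt_of_ne hij with hij | hij
      · exact (h.adj_fwd z' u hij).2 hfz'
      · exact (h.adj_bwd z' u hij).2 hbz'

theorem not_dia_cycle_of_merged (h : T.IsUniform b fwd bwd dia) {x p q r : S} (hx : fwd x x)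
    (hp : fwd x p ∧ fwd p x) (hq : fwd x q ∧ fwd q x) (hr : fwd x r ∧ fwd r x)
    (hpq : dia p q) (hqr : dia q r) (hrp : dia r p) : False := by
  refine hexp (growsAtLeastExponentially_of_sum_cycles (b := fun i => b i ∘ ![p, q, r]) ?_
    (fun i => (h.adj_dia i _ _).2 hpq) (fun i => (h.adj_dia i _ _).2 hqr)
    (fun i => (h.adj_dia i _ _).2 hrp))
  have hM : ∀ a : Fin 3, fwd x (![p, q, r] a) ∧ fwd (![p, q, r] a) x := by
    intro a
    fin_cases a
    exacts [hp, hq, hr]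
  intro i j hij s t
  exact (h.adj_fwd _ _ hij).2 (h.fwd_congr hexp hx
    (h.fwd_self_of_merged hexp hx (hM t).1 (hM t).2) (hM t).1 (hM t).2 (hM s).2)

end IsUniform

/-- A pattern of at most three further vertices `2, 3, 4` witnessing that no acyclic module contains
both ends of the edge from `0` to `1`. -/
def IsCyclicPattern (R : Fin 5 → Fin 5 → Prop) : Prop :=
  R 0 1 ∧ ((R 1 2 ∧ R 2 0) ∨
    (R 0 2 ∧ R 2 1 ∧ R 0 3 ∧ R 3 1 ∧ R 0 4 ∧ R 4 1 ∧ R 2 3 ∧ R 3 4 ∧ R 4 2) ∨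
    (R 0 2 ∧ R 2 1 ∧ R 2 3 ∧ R 3 0) ∨ (R 0 2 ∧ R 2 1 ∧ R 1 3 ∧ R 3 2))

/-- Labels 0 and 1 are merged. In each pattern, betweenness draws further labels into the merged
class until it contains a 3-cycle. -/
theorem IsUniform.grows_of_isCyclicPattern {b : ℕ → Fin 5 → V} {fwd bwd dia : Fin 5 → Fin 5 → Prop}
    (h : T.IsUniform b fwd bwd dia) (h00 : fwd 0 0) (h01 : fwd 0 1) (h10 : fwd 1 0)
    (hdia : IsCyclicPattern dia) : GrowsAtLeastExponentially T.profile := by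
  by_contra hexp
  have m0 : fwd 0 0 ∧ fwd 0 0 := ⟨h00, h00⟩
  have m1 : fwd 0 1 ∧ fwd 1 0 := ⟨h01, h10⟩
  obtain ⟨d01, ⟨d12, d20⟩ | ⟨d02, d21, d03, d31, d04, d41, d23, d34, d42⟩ |
    ⟨d02, d21, d23, d30⟩ | ⟨d02, d21, d13, d32⟩⟩ := hdia
  · have m2 := h.merged_of_dia hexp h00 m1 m0 d12 d20
    exact h.not_dia_cycle_of_merged hexp h00 m0 m1 m2 d01 d12 d20
  · have m2 := h.merged_of_dia hexp h00 m0 m1 d02 d21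
    have m3 := h.merged_of_dia hexp h00 m0 m1 d03 d31
    have m4 := h.merged_of_dia hexp h00 m0 m1 d04 d41
    exact h.not_dia_cycle_of_merged hexp h00 m2 m3 m4 d23 d34 d42
  · have m2 := h.merged_of_dia hexp h00 m0 m1 d02 d21
    have m3 := h.merged_of_dia hexp h00 m2 m0 d23 d30
    exact h.not_dia_cycle_of_merged hexp h00 m0 m2 m3 d02 d23 d30
  · have m2 := h.merged_of_dia hexp h00 m0 m1 d02 d21
    have m3 := h.merged_of_dia hexp h00 m1 m2 d13 d32
    exact h.not_dia_cycle_of_merged hexp h00 m1 m3 m2 d13 d32 d21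

end Tournament
-- Acyclic modules and infinitely many classes
namespace Tournament

variable {V : Type u} {T : Tournament V}

/-- `M` is a module of `T` (every vertex outside `M` dominates all of `M` or none of it) that
contains no 3-cycle. -/
structure IsAcyclicModule (T : Tournament V) (M : Set V) : Prop where
  adj_of_adj : ∀ {x a b : V}, x ∉ M → a ∈ M → b ∈ M → T.Adj x a → T.Adj x b
  acyclic : ∀ {a b c : V}, a ∈ M → b ∈ M → c ∈ M → T.Adj a b → T.Adj b c → ¬ T.Adj c a

/-- `x` and `y` lie in a common acyclic module. -/
def AcyclicallyEquiv (T : Tournament V) (x y : V) : Prop :=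
  ∃ M, T.IsAcyclicModule M ∧ x ∈ M ∧ y ∈ M

theorem isAcyclicModule_singleton (x : V) : T.IsAcyclicModule {x} where
  adj_of_adj := by
    rintro v a b _ rfl rfl h
    exact h
  acyclic := by
    rintro a b c rfl rfl _ h
    exact (T.irrefl _ h).elim

theorem IsAcyclicModule.mem_of_cycle {M : Set V} (hM : T.IsAcyclicModule M) {a b c : V}
    (ha : a ∈ M) (hb : b ∈ M) (hbc : T.Adj b c) (hca : T.Adj c a) : c ∈ M := by
  by_contra hc
  exact asymm hbc (hM.adj_of_adj hc ha hb hca)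

/-- Domination passes from `M` to `N` through `z`. Two vertices of a 3-cycle in the union lie in the
same module, which then contains the third. -/
theorem IsAcyclicModule.union {M N : Set V} (hM : T.IsAcyclicModule M) (hN : T.IsAcyclicModule N)
    {z : V} (hzM : z ∈ M) (hzN : z ∈ N) : T.IsAcyclicModule (M ∪ N) where
  adj_of_adj := by
    intro x a b hx ha hb hxa
    rw [Set.mem_union, not_or] at hx
    have hxz : T.Adj x z := ha.elim (fun ha => hM.adj_of_adj hx.1 ha hzM hxa)
      (fun ha => hN.adj_of_adj hx.2 ha hzN hxa)
    exact hb.elim (fun hb => hM.adj_of_adj hx.1 hzM hb hxz)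
      (fun hb => hN.adj_of_adj hx.2 hzN hb hxz)
  acyclic := by
    intro a b c ha hb hc hab hbc hca
    have two : ∀ {K : Set V}, T.IsAcyclicModule K → ∀ {a b c : V}, T.Adj a b → T.Adj b c →
        T.Adj c a → a ∈ K → b ∈ K → False := fun hK a b c hab hbc hca ha hb =>
      hK.acyclic ha hb (hK.mem_of_cycle ha hb hbc hca) hab hbc hca
    rcases ha with ha | ha <;> rcases hb with hb | hb <;> rcases hc with hc | hc
    · exact two hM hab hbc hca ha hb
    · exact two hM hab hbc hca ha hb
    · exact two hM hca hab hbc hc ha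
    · exact two hN hbc hca hab hb hc
    · exact two hM hbc hca hab hb hc
    · exact two hN hca hab hbc hc ha
    · exact two hN hab hbc hca ha hb
    · exact two hN hab hbc hca ha hb

theorem acyclicallyEquiv_equivalence (T : Tournament V) : Equivalence T.AcyclicallyEquiv where
  refl x := ⟨{x}, isAcyclicModule_singleton x, rfl, rfl⟩
  symm := fun ⟨M, hM, hx, hy⟩ => ⟨M, hM, hy, hx⟩
  trans := fun ⟨M, hM, hx, hy⟩ ⟨N, hN, hy', hz⟩ =>
    ⟨M ∪ N, hM.union hN hy hy', Or.inl hx, Or.inr hz⟩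

/-- The equivalence relation of lying in a common acyclic module. -/
def acyclicSetoid (T : Tournament V) : Setoid V := ⟨_, T.acyclicallyEquiv_equivalence⟩

theorem exists_isCyclicPattern {x y : V} (hxy : T.Adj x y) (h : ¬ T.AcyclicallyEquiv x y) :
    ∃ B : Fin 5 → V, B 0 = x ∧ B 1 = y ∧ IsCyclicPattern fun s t => T.Adj (B s) (B t) := by
  by_contra hcon
  have hpat : ∀ p q r, ¬ IsCyclicPattern fun s t => T.Adj (![x, y, p, q, r] s) (![x, y, p, q, r] t) :=
    fun p q r hp => hcon ⟨_, rfl, rfl, hp⟩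
  have ha : ∀ p, T.Adj y p → ¬ T.Adj p x := fun p h1 h2 =>
    hpat p p p ⟨hxy, Or.inl ⟨h1, h2⟩⟩
  have hb : ∀ p q r, T.Adj x p → T.Adj p y → T.Adj x q → T.Adj q y → T.Adj x r → T.Adj r y →
      T.Adj p q → T.Adj q r → ¬ T.Adj r p := fun p q r h1 h2 h3 h4 h5 h6 h7 h8 h9 =>
    hpat p q r ⟨hxy, Or.inr (Or.inl ⟨h1, h2, h3, h4, h5, h6, h7, h8, h9⟩)⟩
  have hc : ∀ p q, T.Adj x p → T.Adj p y → T.Adj p q → ¬ T.Adj q x := fun p q h1 h2 h3 h4 =>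
    hpat p q q ⟨hxy, Or.inr (Or.inr (Or.inl ⟨h1, h2, h3, h4⟩))⟩
  have hd : ∀ p q, T.Adj x p → T.Adj p y → T.Adj y q → ¬ T.Adj q p := fun p q h1 h2 h3 h4 =>
    hpat p q q ⟨hxy, Or.inr (Or.inr (Or.inr ⟨h1, h2, h3, h4⟩))⟩
  -- Without a pattern this set is an acyclic module: `ha`, `hc`, `hd` exclude outsiders that
  -- distinguish its vertices, `hb` a cycle inside. Shorter patterns repeat vertices in the spare
  -- slots.
  let M : Set V := {z | z = x ∨ z = y ∨ (T.Adj x z ∧ T.Adj z y)}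
  have hxM : ∀ z ∈ M, ¬ T.Adj z x := by
    rintro z (rfl | rfl | hz)
    · exact T.irrefl _
    · exact asymm hxy
    · exact asymm hz.1
  have hyM : ∀ z ∈ M, ¬ T.Adj y z := by
    rintro z (rfl | rfl | hz)
    · exact asymm hxy
    · exact T.irrefl _
    · exact asymm hz.2
  refine h ⟨M, ⟨?_, ?_⟩, Or.inl rfl, Or.inr (Or.inl rfl)⟩
  · intro v a b hv haM hbM hva
    have hv' : v ≠ x ∧ v ≠ y ∧ ¬ (T.Adj x v ∧ T.Adj v y) := by
      simpa only [M, Set.mem_ofPred_eq, not_or] using hv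
    by_cases hvx : T.Adj v x
    · have hvy : T.Adj v y := (not_adj_iff hv'.2.1.symm).1 fun h1 => ha v h1 hvx
      rcases hbM with rfl | rfl | hbM
      · exact hvx
      · exact hvy
      · by_contra hvb
        have hne : v ≠ b := by
          rintro rfl
          exact hv (Or.inr (Or.inr hbM))
        exact hc b v hbM.1 hbM.2 ((not_adj_iff hne).1 hvb) hvx
    · have hxv := (not_adj_iff hv'.1).1 hvx
      have hyv : T.Adj y v := (not_adj_iff hv'.2.1).1 fun h1 => hv'.2.2 ⟨hxv, h1⟩
      exfalso
      rcases haM with rfl | rfl | haM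
      · exact hvx hva
      · exact asymm hyv hva
      · exact hd a v haM.1 haM.2 hyv hva
  · intro a b c haM hbM hcM hab hbc hca
    have inner : ∀ {p q r : V}, p ∈ M → q ∈ M → r ∈ M → T.Adj p q → T.Adj q r →
        T.Adj x q ∧ T.Adj q y := by
      intro p q r hp hq hr hpq hqr
      rcases hq with rfl | rfl | hq
      · exact (hxM p hp hpq).elim
      · exact (hyM r hr hqr).elim
      · exact hq
    have ia := inner hcM haM hbM hca hab
    have ib := inner haM hbM hcM hab hbc
    have ic := inner hbM hcM haM hbc hca
    exact hb a b c ia.1 ia.2 ib.1 ib.2 ic.1 ic.2 hab hbc hca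

theorem growsAtLeastExponentially_of_seq {a : ℕ → V} (ha : ∀ i j, i < j → T.Adj (a i) (a j))
    (hne : ∀ i j, i < j → ¬ T.AcyclicallyEquiv (a i) (a j)) :
    GrowsAtLeastExponentially T.profile := by
  choose B hB0 hB1 hB using fun i : ℕ =>
    exists_isCyclicPattern (ha (2 * i) (2 * i + 1) (by omega)) (hne (2 * i) (2 * i + 1) (by omega))
  -- The colour of a pair of blocks records all edges between them and those inside the first.
  obtain ⟨g, hg, ⟨fwd, bwd, dia⟩, hk⟩ := exists_strictMono_homogeneous fun i j =>
    ((fun s t => T.Adj (B i s) (B j t), fun s t => T.Adj (B j s) (B i t),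
      fun s t => T.Adj (B i s) (B i t)) :
      (Fin 5 → Fin 5 → Prop) × (Fin 5 → Fin 5 → Prop) × (Fin 5 → Fin 5 → Prop))
  simp only [Prod.mk.injEq] at hk
  have hU : T.IsUniform (fun i => B (g i)) fwd bwd dia :=
    { adj_fwd := fun s t hij => iff_of_eq (congrFun (congrFun (hk _ _ hij).1 s) t)
      adj_bwd := fun s t hij => iff_of_eq (congrFun (congrFun (hk _ _ hij).2.1 s) t)
      adj_dia := fun i s t =>
        iff_of_eq (congrFun (congrFun (hk i _ (Nat.lt_succ_self i)).2.2 s) t) }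
  have hg01 : g 0 < g 1 := hg zero_lt_one
  refine hU.grows_of_isCyclicPattern ?_ ?_ ?_ ?_
  · rw [← hU.adj_fwd 0 0 zero_lt_one]
    simp only [hB0]
    exact ha _ _ (by omega)
  · rw [← hU.adj_fwd 0 1 zero_lt_one]
    simp only [hB0, hB1]
    exact ha _ _ (by omega)
  · rw [← hU.adj_fwd 1 0 zero_lt_one]
    simp only [hB0, hB1]
    exact ha _ _ (by omega)
  · rw [← (hk 0 1 zero_lt_one).2.2]
    exact hB (g 0)

/-- The tournament obtained by reversing all edges. -/
def dual (T : Tournament V) : Tournament V where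
  Adj x y := T.Adj y x
  irrefl := T.irrefl
  antisymm x y h h' := T.antisymm x y h' h
  complete x y h := T.complete y x h.symm

theorem profile_dual (T : Tournament V) : T.dual.profile = T.profile := by
  funext n
  have : T.dual.inducedSetoid n = T.inducedSetoid n := by
    ext s t
    exact ⟨fun ⟨e⟩ => ⟨⟨e.toEquiv, fun {_ _} => e.map_rel_iff⟩⟩,
      fun ⟨e⟩ => ⟨⟨e.toEquiv, fun {_ _} => e.map_rel_iff⟩⟩⟩
  unfold profile
  rw [this]

theorem AcyclicallyEquiv.of_dual {x y : V} (h : T.dual.AcyclicallyEquiv x y) :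
    T.AcyclicallyEquiv x y := by
  obtain ⟨M, hM, hx, hy⟩ := h
  refine ⟨M, ⟨?_, ?_⟩, hx, hy⟩
  · intro v a b hv ha hb hva
    have hne : b ≠ v := by
      rintro rfl
      exact hv hb
    exact (not_adj_iff hne).1 fun h1 => asymm hva (hM.adj_of_adj hv hb ha h1)
  · intro a b c ha hb hc hab hbc hca
    exact hM.acyclic hc hb ha hbc hab hca

theorem growsAtLeastExponentially_of_infinite_quotient
    (h : Infinite (Quotient T.acyclicSetoid)) : GrowsAtLeastExponentially T.profile := by
  let a : ℕ → V := fun i => (Infinite.natEmbedding (Quotient T.acyclicSetoid) i).out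
  have hne : ∀ i j, i ≠ j → ¬ T.AcyclicallyEquiv (a i) (a j) := by
    intro i j hij hequiv
    exact hij ((Infinite.natEmbedding _).injective
      ((Quotient.out_equiv_out (s := T.acyclicSetoid)).1 hequiv))
  obtain ⟨g, hg, k, hk⟩ := exists_strictMono_homogeneous fun i j => T.Adj (a i) (a j)
  by_cases hk' : k
  · exact growsAtLeastExponentially_of_seq (a := a ∘ g) (fun i j hij => (hk i j hij).symm ▸ hk')
      fun i j hij => hne _ _ (hg hij).ne
  · rw [← profile_dual]
    refine growsAtLeastExponentially_of_seq (a := a ∘ g) (fun i j hij => ?_)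
      fun i j hij he => hne _ _ (hg hij).ne he.of_dual
    have hane : a (g i) ≠ a (g j) := fun he =>
      hne _ _ (hg hij).ne (he ▸ T.acyclicallyEquiv_equivalence.refl _)
    exact (not_adj_iff hane).1 fun h1 => hk' ((hk i j hij) ▸ h1)

/-! ### Finitely many classes: lexicographical sums and the polynomial bound -/

theorem isomorphic_lexSum_fibers {ι : Type v} (D : Tournament ι) (π : V → ι)
    (hπ : ∀ x y, π x ≠ π y → (T.Adj x y ↔ D.Adj (π x) (π y))) :
    T.Isomorphic (D.lexSum fun i => T.restrict {x | π x = i}) := by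
  refine ⟨RelIso.symm ⟨Equiv.sigmaFiberEquiv π, ?_⟩⟩
  rintro ⟨i, x, rfl⟩ ⟨j, y, rfl⟩
  change T.Adj x y ↔ Sigma.Lex _ _ _ _
  rw [Sigma.lex_iff]
  by_cases h : π x = π y
  · constructor
    · intro hxy
      refine Or.inr ⟨h, ?_⟩
      have gen : ∀ (j : ι) (hj : π x = j) (hy : π y = j),
          (T.restrict {z | π z = j}).Adj (hj ▸ ⟨x, rfl⟩) ⟨y, hy⟩ := by
        rintro _ rfl _
        exact hxy
      exact gen _ h rfl
    · rintro (h1 | ⟨h1, h2⟩)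
      · change D.Adj (π x) (π y) at h1
        rw [h] at h1
        exact (D.irrefl _ h1).elim
      · have gen : ∀ (j : ι) (hj : π x = j) (hy : π y = j),
            (T.restrict {z | π z = j}).Adj (hj ▸ ⟨x, rfl⟩) ⟨y, hy⟩ → T.Adj x y := by
          rintro _ rfl _ h3
          exact h3
        exact gen _ h1 rfl h2
  · rw [hπ x y h]
    refine ⟨Or.inl, ?_⟩
    rintro (h1 | ⟨h1, -⟩)
    · exact h1
    · exact (h h1).elim

theorem isFiniteLexSumOfAcyclic_of_finite_quotient (h : Finite (Quotient T.acyclicSetoid)) :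
    T.IsFiniteLexSumOfAcyclic := by
  obtain ⟨n, ⟨e⟩⟩ := Finite.exists_equiv_fin (Quotient T.acyclicSetoid)
  let π : V → Fin n := fun x => e (Quotient.mk _ x)
  have hπ : ∀ {x y}, π x = π y ↔ T.AcyclicallyEquiv x y := fun {x y} =>
    e.injective.eq_iff.trans (Quotient.eq (r := T.acyclicSetoid))
  let rep : Fin n → V := fun i => (e.symm i).out
  have hrep : ∀ i, π (rep i) = i := fun i => by simp [π, rep]
  have hreps : ∀ x, T.AcyclicallyEquiv x (rep (π x)) := fun x => hπ.1 (hrep _).symm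
  have hrepi : Function.Injective rep := fun i j hij => by rw [← hrep i, ← hrep j, hij]
  let D : Tournament (Fin n) :=
    { Adj := fun i j => T.Adj (rep i) (rep j)
      irrefl := fun i => T.irrefl _
      antisymm := fun i j h h' => hrepi (T.antisymm _ _ h h')
      complete := fun i j h => T.complete _ _ (hrepi.ne h) }
  -- Move y to y' inside `N`, which misses x, and then x to x' inside `M`, which misses y'.
  have hcongr : ∀ {x x' y y'}, ¬ T.AcyclicallyEquiv x y → T.AcyclicallyEquiv x x' →
      T.AcyclicallyEquiv y y' → T.Adj x y → T.Adj x' y' := by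
    rintro x x' y y' hxy ⟨M, hM, hx, hx'⟩ ⟨N, hN, hy, hy'⟩ hadj
    have hxN : x ∉ N := fun hxN => hxy ⟨N, hN, hxN, hy⟩
    have hyM : y' ∉ M := fun hyM => hxy
      (T.acyclicallyEquiv_equivalence.trans ⟨M, hM, hx, hyM⟩ ⟨N, hN, hy', hy⟩)
    have h1 := hN.adj_of_adj hxN hy hy' hadj
    have hne : y' ≠ x' := by
      rintro rfl
      exact hyM hx'
    exact (not_adj_iff hne).1 fun h2 => asymm h1 (hM.adj_of_adj hyM hx' hx h2)
  refine ⟨Fin n, inferInstance, D, _, fun i => T.restrict {x | π x = i}, ?_,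
    isomorphic_lexSum_fibers D π ?_⟩
  · rintro i ⟨⟨a, ha⟩, ⟨b, hb⟩, ⟨c, hc⟩, hab, hbc, hca⟩
    obtain ⟨M, hM, haM, hbM⟩ := hπ.1 (Eq.trans (b := i) ha (Eq.symm hb))
    obtain ⟨N, hN, hbN, hcN⟩ := hπ.1 (Eq.trans (b := i) hb (Eq.symm hc))
    exact (hM.union hN hbM hbN).acyclic (Or.inl haM) (Or.inl hbM) (Or.inr hcN) hab hbc hca
  · intro x y hxy
    have hxy' : ¬ T.AcyclicallyEquiv x y := fun h => hxy (hπ.2 h)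
    refine ⟨hcongr hxy' (hreps x) (hreps y), hcongr ?_ ?_ ?_⟩
    · rw [← hπ, hrep, hrep]
      exact hxy
    · exact T.acyclicallyEquiv_equivalence.symm (hreps x)
    · exact T.acyclicallyEquiv_equivalence.symm (hreps y)

/-- The transitive tournament on `k` vertices. -/
def chain (k : ℕ) : Tournament (Fin k) where
  Adj x y := x < y
  irrefl := lt_irrefl
  antisymm _ _ h h' := (lt_asymm h h').elim
  complete _ _ h := lt_or_gt_of_ne h

theorem IsAcyclic.isomorphic_chain [Finite V] (hT : T.IsAcyclic) :
    T.Isomorphic (chain (Nat.card V)) := by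
  classical
  have : Fintype V := Fintype.ofFinite V
  have : IsStrictTotalOrder V T.Adj :=
    { trichotomous := fun _ _ => eq_of_not_adj
      irrefl := T.irrefl
      trans := fun a b c hab hbc => by
        have hne : c ≠ a := by
          rintro rfl
          exact asymm hab hbc
        exact (not_adj_iff hne).1 fun hca => hT ⟨a, b, c, hab, hbc, hca⟩ }
  let _ : LinearOrder V := linearOrderOfSTO T.Adj
  let e := (Fintype.orderIsoFinOfCardEq V (Nat.card_eq_fintype_card (α := V)).symm).symm
  exact ⟨⟨e.toEquiv, fun {_ _} => e.lt_iff_lt⟩⟩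

theorem Isomorphic.lexSum_congr {ι : Type v} {W W' : ι → Type*} {D : Tournament ι}
    {S : ∀ i, Tournament (W i)} {S' : ∀ i, Tournament (W' i)} (h : ∀ i, (S i).Isomorphic (S' i)) :
    (D.lexSum S).Isomorphic (D.lexSum S') := by
  let e := fun i => (h i).some
  refine ⟨⟨Equiv.sigmaCongrRight fun i => (e i).toEquiv, ?_⟩⟩
  rintro ⟨i, x⟩ ⟨j, y⟩
  change Sigma.Lex _ _ _ _ ↔ Sigma.Lex _ _ _ _
  rw [Sigma.lex_iff, Sigma.lex_iff]
  refine or_congr Iff.rfl ⟨?_, ?_⟩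
  · rintro ⟨h, h'⟩
    obtain rfl : i = j := h
    exact ⟨rfl, (e i).map_rel_iff.1 h'⟩
  · rintro ⟨h, h'⟩
    obtain rfl : i = j := h
    exact ⟨rfl, (e i).map_rel_iff.2 h'⟩

/-- A finite acyclic tournament is determined by its size, so an n-element subtournament is
determined by its numbers of vertices in the summands, each at most n. -/
theorem isPolynomiallyBounded_of_isFiniteLexSumOfAcyclic (hT : T.IsFiniteLexSumOfAcyclic) :
    IsPolynomiallyBounded T.profile := by
  classical
  obtain ⟨ι, _, D, W, S, hS, ⟨e⟩⟩ := hT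
  let π : V → ι := fun x => (e x).1
  have hπ : ∀ x y, π x ≠ π y → (T.Adj x y ↔ D.Adj (π x) (π y)) := by
    intro x y hxy
    rw [← e.map_rel_iff]
    change Sigma.Lex _ _ _ _ ↔ _
    rw [Sigma.lex_iff]
    exact ⟨fun h => h.resolve_right fun h => hxy h.1, Or.inl⟩
  have hfib : ∀ a b c, π a = π b → π b = π c → T.Adj a b → T.Adj b c → ¬ T.Adj c a := by
    intro a b c hab hbc h1 h2 h3
    rw [← e.map_rel_iff] at h1 h2 h3
    change (e a).1 = (e b).1 at hab
    change (e b).1 = (e c).1 at hbc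
    generalize e a = a' at *
    generalize e b = b' at *
    generalize e c = c' at *
    obtain ⟨i, a'⟩ := a'
    obtain ⟨j, b'⟩ := b'
    obtain ⟨k, c'⟩ := c'
    obtain rfl : i = j := hab
    obtain rfl : i = k := hbc
    have key : ∀ p q : W i, Sigma.Lex D.Adj (fun i => (S i).Adj) ⟨i, p⟩ ⟨i, q⟩ → (S i).Adj p q := by
      intro p q h
      rcases Sigma.lex_iff.1 h with h | ⟨_, h⟩
      · exact (D.irrefl _ h).elim
      · exact h
    exact hS i ⟨a', b', c', key _ _ h1, key _ _ h2, key _ _ h3⟩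
  let cnt : ∀ s : Finset V, ι → ℕ := fun s i => Nat.card {x : (s : Set V) | π x = i}
  have hcnt : ∀ s : Finset V,
      (T.restrict (s : Set V)).Isomorphic (D.lexSum fun i => chain (cnt s i)) := by
    intro s
    obtain ⟨f⟩ := isomorphic_lexSum_fibers (T := T.restrict (s : Set V)) D (fun x => π x)
      fun x y h => hπ x y h
    obtain ⟨g⟩ := Isomorphic.lexSum_congr (D := D)
      (S := fun i => (T.restrict (s : Set V)).restrict {x | π x = i})
      (S' := fun i => chain (cnt s i)) fun i => by
        refine IsAcyclic.isomorphic_chain ?_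
        rintro ⟨a, b, c, hab, hbc, hca⟩
        exact hfib a.1.1 b.1.1 c.1.1 (Eq.trans (b := i) a.2 (Eq.symm b.2))
          (Eq.trans (b := i) b.2 (Eq.symm c.2)) hab hbc hca
    exact ⟨f.trans g⟩
  have hle : ∀ (s : Finset V) i, cnt s i ≤ s.card := by
    intro s i
    exact (Nat.card_le_card_of_injective
      (Subtype.val : {x : (s : Set V) | π x = i} → (s : Set V)) Subtype.val_injective).trans_eq
      (by simp)
  have hbound : ∀ n, T.profile n ≤ (n + 1) ^ Nat.card ι := by
    intro n
    have : Fintype ι := Fintype.ofFinite ι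
    let F : Quotient (T.inducedSetoid n) → ι → Fin (n + 1) := fun q i =>
      ⟨cnt q.out.1 i, Nat.lt_succ_of_le ((hle _ i).trans_eq q.out.2)⟩
    have hF : Function.Injective F := by
      intro q q' h
      have hc : cnt q.out.1 = cnt q'.out.1 :=
        funext fun i => congrArg Fin.val (congrFun h i)
      rw [← Quotient.out_equiv_out]
      obtain ⟨f⟩ := hcnt q.out.1
      obtain ⟨f'⟩ := hcnt q'.out.1
      rw [hc] at f
      exact ⟨f.trans f'.symm⟩
    simpa [profile] using Nat.card_le_card_of_injective F hF
  refine ⟨(Polynomial.X + 1) ^ Nat.card ι, fun n => ?_⟩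
  simpa using (Nat.cast_le (α := ℝ)).2 (hbound n)

end Tournament

theorem theorem5 {V : Type u} (T : Tournament V) :
    (IsPolynomiallyBounded T.profile ∨ GrowsAtLeastExponentially T.profile) ∧
    ¬ (IsPolynomiallyBounded T.profile ∧ GrowsAtLeastExponentially T.profile) ∧
    (IsPolynomiallyBounded T.profile → T.IsFiniteLexSumOfAcyclic) := by
  have hnot := not_isPolynomiallyBounded_and_growsAtLeastExponentially T.profile
  rcases finite_or_infinite (Quotient T.acyclicSetoid) with h | h
  · have hT := Tournament.isFiniteLexSumOfAcyclic_of_finite_quotient h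
    exact ⟨Or.inl (Tournament.isPolynomiallyBounded_of_isFiniteLexSumOfAcyclic hT), hnot,
      fun _ => hT⟩
  · have hT := Tournament.growsAtLeastExponentially_of_infinite_quotient h
    exact ⟨Or.inr hT, hnot, fun hp => (hnot ⟨hp, hT⟩).elim⟩
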